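/- Let $L$ be an algebraically closed field (of any characteristic) and let $X_1, X_2, X_3$ be smooth projective varieties over $L$, i.e. irreducible and reduced closed subschemes of projective spaces over $L$ (up to $L$-isomorphism) that are smooth over $L$. For a finite morphism $h : X \to Y$ of such varieties over $L$ and a (closed) point $a \in X$, the algebraic multiplicity of $h$ at $a$ is $$\mathrm{mult}_{a,h(a)}(X/Y) = \mathrm{length}_{\mathcal{O}_{X,a}}\bigl(\mathcal{O}_{X,a}/h^{*}\mathfrak{m}_{h(a)}\bigr),$$ where $\mathfrak{m}_{h(a)}$ is the maximal ideal of $\mathcal{O}_{Y,h(a)}$ and $h^{*}\mathfrak{m}_{h(a)}$ denotes the ideal that it generates in $\mathcal{O}_{X,a}$. **Theorem 5.10.** Let $f : X_3 \to X_2$ and $g : X_2 \to X_1$ be finite morphisms over $L$, with $f$ surjective. Then for every (closed) point $a \in X_3$ the multiplicities $\mathrm{mult}_{a,f(a)}(X_3/X_2)$ and $\mathrm{mult}_{f(a),gf(a)}(X_2/X_1)$ are finite, and $$\mathrm{mult}_{a,f(a)}(X_3/X_2)\cdot \mathrm{mult}_{f(a),gf(a)}(X_2/X_1) = \mathrm{mult}_{a,gf(a)}(X_3/X_1).$$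 -/

import Mathlib

open CategoryTheory

universe u

attribute [local instance] MvPolynomial.gradedAlgebra

/-- Projective `n`-space over a field `L`: `Proj` of `L[x₀, …, xₙ]` with its usual grading. -/
noncomputable abbrev ProjSpace (n : ℕ) (L : Type u) [Field L] : AlgebraicGeometry.Scheme.{u} :=
  AlgebraicGeometry.Proj (MvPolynomial.homogeneousSubmodule (Fin (n + 1)) L)

/-- The structure morphism of projective space, induced by `L → L[x₀, …, xₙ]`, whose image lies
in degree `0`. -/
noncomputable def ProjSpace.toSpec (n : ℕ) (L : Type u) [Field L] :
    ProjSpace n L ⟶ AlgebraicGeometry.Spec (CommRingCat.of L) :=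
  AlgebraicGeometry.Proj.toSpecZero (MvPolynomial.homogeneousSubmodule (Fin (n + 1)) L) ≫
    AlgebraicGeometry.Spec.map (CommRingCat.ofHom
      (algebraMap L (MvPolynomial.homogeneousSubmodule (Fin (n + 1)) L 0)))

/-- The `L`-scheme `s : X ⟶ Spec L` is a smooth projective variety over `L`: it is integral
(irreducible and reduced), it is isomorphic over `L` to a closed subscheme of some projective
space, and it is smooth over `L`. The points of the variety are the closed points of `X`. -/
structure IsSmoothProjectiveVariety {L : Type u} [Field L] {X : AlgebraicGeometry.Scheme.{u}}
    (s : X ⟶ AlgebraicGeometry.Spec (CommRingCat.of L)) : Prop where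
  isIntegral : AlgebraicGeometry.IsIntegral X
  exists_closedImmersion : ∃ (n : ℕ) (i : X ⟶ ProjSpace n L),
    AlgebraicGeometry.IsClosedImmersion i ∧ i ≫ ProjSpace.toSpec n L = s
  smooth : AlgebraicGeometry.Smooth s

/-- The algebraic multiplicity of `f : X ⟶ Y` at `a`: the length of `𝒪_{X,a} / f^* 𝔪_{f(a)}`, where
`f^* 𝔪_{f(a)}` is the ideal of `𝒪_{X,a}` generated by the image of the maximal ideal of
`𝒪_{Y,f(a)}`. -/
noncomputable def algMultiplicity {X Y : AlgebraicGeometry.Scheme.{u}} (f : X ⟶ Y) (a : X) : ℕ∞ :=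
  Module.length (X.presheaf.stalk a)
    (X.presheaf.stalk a ⧸
      (IsLocalRing.maximalIdeal (Y.presheaf.stalk (f a))).map (f.stalkMap a).hom)

/-! Let B → C be the map of local rings at f(a) and a. If C were flat over B, tensoring a
composition series of B/I with C would give length(C/IC) = length(C/m_B C) · length(B/I), which is
the claim for I = g^*m. Only Tor₁(C, B/m_B) = 0 is needed, that is, injectivity of C ⊗ m_B → C
(`length_tensorProduct_of_lTensor_maximalIdeal_injective`). Smoothness gives B and C regular systems
of parameters whose lengths are their transcendence degrees over L
(`AlgebraicGeometry.Smooth.exists_regularParameters`). As f is finite and surjective, B → C is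
injective and algebraic, so the lengths agree. The parameters of B have Artinian quotient C/m_B C,
so they form a system of parameters of C, hence a regular sequence since C is Cohen-Macaulay
(`Algebra.QuasiFinite.isWeaklyRegular_of_ofList_eq_maximalIdeal`); this kills Tor₁. The
multiplicities are finite because C/m_B C is finite over the residue field of B. -/

open RingTheory.Sequence TensorProduct

/-! ### Vanishing of Tor₁ for regular sequences, by elements -/

section Tor

variable {R M : Type*} [CommRing R] [AddCommGroup M] [Module R M]

lemma Ideal.exists_eq_sum_smul_of_mem_ofList_ofFn_smul_top {n : ℕ} (x : Fin n → R) {m : M}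
    (hm : m ∈ (Ideal.ofList (List.ofFn x) • ⊤ : Submodule R M)) :
    ∃ e : Fin n → M, m = ∑ i, x i • e i := by
  refine Submodule.smul_induction_on hm (fun r hr m _ ↦ ?_) ?_
  · have hr' : r ∈ Ideal.span (Set.range x) := by
      convert hr using 2
      ext; simp [List.mem_ofFn]
    obtain ⟨a, rfl⟩ := (Ideal.mem_span_range_iff_exists_fun).mp hr'
    refine ⟨fun i ↦ a i • m, ?_⟩
    rw [Finset.sum_smul]
    exact Finset.sum_congr rfl fun i _ ↦ by rw [smul_smul, mul_comm]
  · rintro _ _ ⟨e, rfl⟩ ⟨e', rfl⟩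
    exact ⟨e + e', by simp [Finset.sum_add_distrib]⟩

/-- Every linear relation between the members of a weakly regular sequence is trivial. -/
lemma RingTheory.Sequence.IsWeaklyRegular.sum_tmul_eq_zero {J : Ideal R} {n : ℕ} (x : Fin n → J)
    (reg : IsWeaklyRegular M (List.ofFn fun i ↦ (x i : R))) (c : Fin n → M)
    (h : ∑ i, (x i : R) • c i = 0) : ∑ i, c i ⊗ₜ[R] x i = 0 := by
  induction n with
  | zero => simp
  | succ n ih =>
    rw [List.ofFn_succ', List.concat_eq_append, isWeaklyRegular_append_iff,
      isWeaklyRegular_singleton_iff] at reg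
    rw [Fin.sum_univ_castSucc] at h
    have hmem : c (Fin.last n) ∈
        (Ideal.ofList (List.ofFn fun i : Fin n ↦ (x i.castSucc : R)) • ⊤ : Submodule R M) := by
      rw [← Submodule.Quotient.mk_eq_zero]
      apply reg.2
      simp only [smul_zero, ← Submodule.Quotient.mk_smul]
      rw [Submodule.Quotient.mk_eq_zero, eq_neg_of_add_eq_zero_right h]
      refine neg_mem (sum_mem fun i _ ↦ Submodule.smul_mem_smul (Ideal.subset_span ?_) trivial)
      simp [List.mem_ofFn]
    obtain ⟨e, he⟩ := Ideal.exists_eq_sum_smul_of_mem_ofList_ofFn_smul_top _ hmem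
    -- Substituting c_n = ∑ x_i e_i shortens the relation; the tensors agree because x_i e_i ⊗ x_n =
    -- x_n e_i ⊗ x_i.
    have := ih (fun i ↦ x i.castSucc) reg.1 (fun i ↦ c i.castSucc + (x (Fin.last n) : R) • e i) (by
      rw [he, Finset.smul_sum, ← Finset.sum_add_distrib] at h
      rw [← h]
      exact Finset.sum_congr rfl fun i _ ↦ by rw [smul_add, smul_comm])
    rw [Fin.sum_univ_castSucc, ← this, he, sum_tmul, ← Finset.sum_add_distrib]
    refine Finset.sum_congr rfl fun i _ ↦ ?_
    rw [add_tmul, smul_tmul, smul_tmul]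
    congr 2
    ext
    simp [mul_comm]

/-- A tensor ∑ c_i ⊗ x_i in the kernel is a linear relation between the x_i, and such relations are
trivial. -/
lemma RingTheory.Sequence.IsWeaklyRegular.lTensor_subtype_injective {rs : List R}
    (reg : IsWeaklyRegular M rs) :
    Function.Injective ((Ideal.ofList rs).subtype.lTensor M) := by
  set J := Ideal.ofList rs
  have hmem (i : Fin rs.length) : rs.get i ∈ J := Ideal.subset_span (rs.get_mem i)
  let x (i : Fin rs.length) : J := ⟨rs.get i, hmem i⟩
  have hx : (List.ofFn fun i ↦ (x i : R)) = rs := List.ofFn_get rs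
  have hspan : Submodule.span R (Set.range x) = ⊤ := by
    refine Submodule.map_injective_of_injective J.injective_subtype ?_
    rw [Submodule.map_span, Submodule.map_top, Submodule.range_subtype, ← Set.range_comp]
    refine congrArg (Submodule.span R) (Set.ext fun r ↦ ?_)
    simp [x, List.mem_iff_get]
  have hsum (t : M ⊗[R] J) : ∃ c : Fin rs.length → M, t = ∑ i, c i ⊗ₜ x i := by
    induction t with
    | zero => exact ⟨0, by simp⟩
    | add s t hs ht =>
      obtain ⟨c, rfl⟩ := hs
      obtain ⟨d, rfl⟩ := ht
      exact ⟨c + d, by simp [add_tmul, Finset.sum_add_distrib]⟩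
    | tmul m j =>
      obtain ⟨a, rfl⟩ := (Submodule.mem_span_range_iff_exists_fun R).mp (hspan.symm ▸ trivial :
        j ∈ Submodule.span R (Set.range x))
      exact ⟨fun i ↦ a i • m, by simp [tmul_sum, smul_tmul]⟩
  rw [injective_iff_map_eq_zero]
  intro t ht
  obtain ⟨c, rfl⟩ := hsum t
  refine IsWeaklyRegular.sum_tmul_eq_zero x (by rwa [hx]) c ?_
  simpa using congrArg (TensorProduct.rid R M) ht

/-- If `M ⊗ I → M` is injective, then `M ⊗ -` preserves the injectivity of submodules with
quotient `R ⧸ I`. -/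
lemma lTensor_subtype_injective_of_quotient_equiv {I : Ideal R}
    (hI : Function.Injective (I.subtype.lTensor M)) {P : Type*} [AddCommGroup P] [Module R P]
    (N : Submodule R P) (e : (P ⧸ N) ≃ₗ[R] R ⧸ I) :
    Function.Injective (N.subtype.lTensor M) := by
  obtain ⟨z, hz⟩ := N.mkQ_surjective (e.symm 1)
  have hz' (r : R) : N.mkQ (r • z) = e.symm (Ideal.Quotient.mk I r) := by
    rw [map_smul, hz, ← map_smul]
    congr 1
    rw [← mul_one (Ideal.Quotient.mk I r)]
    rfl
  have hzN (r : R) : r • z ∈ N ↔ r ∈ I := by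
    rw [← Submodule.Quotient.mk_eq_zero, ← Submodule.mkQ_apply, hz',
      LinearEquiv.map_eq_zero_iff, Ideal.Quotient.eq_zero_iff_mem]
  let φ : I →ₗ[R] N :=
    ((LinearMap.toSpanSingleton R P z).comp I.subtype).codRestrict N fun i ↦ (hzN i).mpr i.2
  have hφ (i : I) : (φ i : P) = (i : R) • z := rfl
  -- With z lifting the generator of P/N, P is the pushout of N and R along I: I → N × R → P → 0 is
  -- exact and stays so after tensoring.
  let ψ : I →ₗ[R] N × R := φ.prod (-I.subtype)
  let π : N × R →ₗ[R] P := N.subtype.coprod (LinearMap.toSpanSingleton R P z)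
  have hψπ : Function.Exact ψ π := by
    rintro ⟨n, r⟩
    constructor
    · intro h
      have h' : (n : P) + r • z = 0 := by simpa [π] using h
      have hr : r ∈ I := (hzN r).mp (by rw [eq_neg_of_add_eq_zero_right h']; exact neg_mem n.2)
      refine ⟨-⟨r, hr⟩, Prod.ext (Subtype.ext ?_) (by simp [ψ])⟩
      simp [ψ, hφ, eq_neg_of_add_eq_zero_left h']
    · rintro ⟨i, hi⟩
      rw [← hi]
      simp [ψ, π, hφ]
  have hπ : Function.Surjective π := by
    intro p
    obtain ⟨r, hr⟩ := Ideal.Quotient.mk_surjective (e (N.mkQ p))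
    have : p - r • z ∈ N := by
      rw [← Submodule.Quotient.mk_eq_zero, ← Submodule.mkQ_apply, map_sub, hz', hr,
        LinearEquiv.symm_apply_apply, sub_self]
    exact ⟨(⟨_, this⟩, r), by simp [π]⟩
  rw [injective_iff_map_eq_zero]
  intro t ht
  have h1 : π.lTensor M ((LinearMap.inl R N R).lTensor M t) = 0 := by
    rw [← LinearMap.comp_apply, ← LinearMap.lTensor_comp, LinearMap.coprod_inl, ht]
  -- The R-coordinate forces v = 0 by `hI`; the N-coordinate then gives t = 0.
  obtain ⟨v, hv⟩ := (lTensor_exact M hψπ hπ _).mp h1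
  have h2 := congrArg ((LinearMap.snd R N R).lTensor M) hv
  rw [← LinearMap.comp_apply, ← LinearMap.comp_apply, ← LinearMap.lTensor_comp,
    ← LinearMap.lTensor_comp, LinearMap.snd_prod, LinearMap.snd_comp_inl, LinearMap.lTensor_zero,
    LinearMap.lTensor_neg, LinearMap.neg_apply, LinearMap.zero_apply, neg_eq_zero,
    ← map_zero (I.subtype.lTensor M)] at h2
  rw [hI h2, map_zero] at hv
  have h3 := congrArg ((LinearMap.fst R N R).lTensor M) hv
  rw [← LinearMap.comp_apply, ← LinearMap.lTensor_comp, LinearMap.fst_comp_inl,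
    LinearMap.lTensor_id, map_zero] at h3
  exact h3.symm

end Tor

/-! ### Multiplicativity of length under base change -/

section Length

open IsLocalRing

variable {R S : Type*} [CommRing R] [CommRing S] [Algebra R S] [IsLocalRing R]

lemma length_tensorProduct_of_lTensor_maximalIdeal_injective
    (h : Function.Injective ((maximalIdeal R).subtype.lTensor S))
    {N : Type*} [AddCommGroup N] [Module R N] (hN : IsFiniteLength R N) :
    Module.length S (S ⊗[R] N) =
      Module.length S (S ⧸ (maximalIdeal R).map (algebraMap R S)) * Module.length R N := by
  induction hN with
  | of_subsingleton => simp [Module.length_eq_zero]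
  | @of_simple_quotient P _ _ N _ hN ih =>
    obtain ⟨I, hI, ⟨e⟩⟩ := isSimpleModule_iff_quot_maximal.mp ‹IsSimpleModule R (P ⧸ N)›
    obtain rfl := eq_maximalIdeal hI
    have hinj := lTensor_subtype_injective_of_quotient_equiv h N e
    rw [Module.length_eq_add_of_exact N.subtype N.mkQ N.injective_subtype N.mkQ_surjective
        (LinearMap.exact_subtype_mkQ N), Module.length_eq_one R (P ⧸ N), mul_add, mul_one, ← ih,
      Module.length_eq_add_of_exact (AlgebraTensorModule.lTensor S S N.subtype)
        (AlgebraTensorModule.lTensor S S N.mkQ) hinj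
        (LinearMap.lTensor_surjective S N.mkQ_surjective)
        (lTensor_exact S (LinearMap.exact_subtype_mkQ N) N.mkQ_surjective)]
    congr 1
    exact ((Ideal.qoutMapEquivTensorQout S (I := maximalIdeal R)).trans
      (AlgebraTensorModule.congr (LinearEquiv.refl S S) e.symm)).symm.length_eq

lemma length_quotient_map_of_lTensor_maximalIdeal_injective
    (h : Function.Injective ((maximalIdeal R).subtype.lTensor S)) (I : Ideal R)
    (hI : Module.length R (R ⧸ I) ≠ ⊤) :
    Module.length S (S ⧸ I.map (algebraMap R S)) =
      Module.length S (S ⧸ (maximalIdeal R).map (algebraMap R S)) * Module.length R (R ⧸ I) := by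
  rw [(Ideal.qoutMapEquivTensorQout S (I := I)).length_eq,
    length_tensorProduct_of_lTensor_maximalIdeal_injective h (Module.length_ne_top_iff.mp hI)]

end Length

/-! ### Depth, and systems of parameters in Cohen-Macaulay modules -/

section Depth

open IsLocalRing Pointwise

variable {R : Type u} [CommRing R] [IsLocalRing R] [IsNoetherianRing R]

/-- The submodule N killed by p is nonzero. If N ⊆ rM, regularity of r gives N = rN, contradicting
Nakayama; so some n ∈ N survives in M/rM, and p and r both kill it there. -/
lemma IsAssociatedPrime.exists_le_isAssociatedPrime_quotSMulTop {M : Type*} [AddCommGroup M]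
    [Module R M] [Module.Finite R M] {p : Ideal R} (hp : IsAssociatedPrime p M) {r : R}
    (hr : r ∈ maximalIdeal R) (hreg : IsSMulRegular M r) :
    ∃ q, IsAssociatedPrime q (QuotSMulTop r M) ∧ p ≤ q ∧ r ∈ q := by
  obtain ⟨-, x, hx⟩ := isAssociatedPrime_iff.mp hp
  have hx0 : x ≠ 0 := by
    rintro rfl
    exact hp.isPrime.ne_top (by simp [hx])
  let N := Submodule.torsionBySet R M (p : Set R)
  have hN (m : M) : m ∈ N ↔ ∀ a ∈ p, a • m = 0 := by
    simp [N, Submodule.mem_torsionBySet_iff]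
  have hxN : x ∈ N := (hN x).mpr fun a ha ↦ by
    rw [hx, Submodule.mem_colon_singleton] at ha
    simpa using ha
  obtain ⟨n, hn, hnr⟩ : ∃ n ∈ N, n ∉ (r • ⊤ : Submodule R M) := by
    by_contra! h
    have hle : N ≤ maximalIdeal R • N := by
      intro n hn
      obtain ⟨y, -, rfl⟩ := (Submodule.mem_smul_pointwise_iff_exists _ _ _).mp (h n hn)
      refine Submodule.smul_mem_smul hr ((hN y).mpr fun a ha ↦ hreg ?_)
      simpa [smul_comm r a] using (hN _).mp hn a ha
    have := Submodule.eq_bot_of_le_smul_of_le_jacobson_bot (maximalIdeal R) N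
      (IsNoetherian.noetherian N) hle (maximalIdeal_le_jacobson _)
    rw [this] at hxN
    exact hx0 hxN
  obtain ⟨q, hq, hle⟩ := exists_le_isAssociatedPrime_of_isNoetherianRing R
    (Submodule.Quotient.mk n : QuotSMulTop r M) (by rwa [ne_eq, Submodule.Quotient.mk_eq_zero])
  refine ⟨q, hq, fun a ha ↦ hle ?_, hle ?_⟩
  · rw [Submodule.mem_colon_singleton, ← Submodule.Quotient.mk_smul, (hN n).mp hn a ha]
    simp
  · rw [Submodule.mem_colon_singleton, Submodule.mem_bot, ← Submodule.Quotient.mk_smul,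
      Submodule.Quotient.mk_eq_zero]
    exact Submodule.smul_mem_pointwise_smul _ _ _ trivial

/-- The depth of a module is at most the dimension of each of its associated primes. -/
lemma RingTheory.Sequence.IsRegular.length_le_ringKrullDim_quotient {M : Type*} [AddCommGroup M]
    [Module R M] [Module.Finite R M] {rs : List R} (hrs : IsRegular M rs)
    (hmem : ∀ r ∈ rs, r ∈ maximalIdeal R) {p : Ideal R} (hp : IsAssociatedPrime p M) :
    (rs.length : WithBot ℕ∞) ≤ ringKrullDim (R ⧸ p) := by
  induction rs generalizing M p with
  | nil =>
    have := Ideal.Quotient.nontrivial_iff.mpr hp.isPrime.ne_top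
    simpa using ringKrullDim_nonneg_of_nontrivial
  | cons r rs ih =>
    obtain ⟨hr, hrs⟩ := (isRegular_cons_iff M r rs).mp hrs
    obtain ⟨q, hq, hpq, hrq⟩ :=
      hp.exists_le_isAssociatedPrime_quotSMulTop (hmem r (by simp)) hr
    have hrp : r ∉ p := by
      obtain ⟨hp', x, hx⟩ := isAssociatedPrime_iff.mp hp
      intro h
      rw [hx, Submodule.mem_colon_singleton, Submodule.mem_bot] at h
      have : x = 0 := hr (by simpa using h)
      exact hp'.ne_top (by simp [hx, this])
    have := hp.isPrime
    have hdim := ringKrullDim_succ_le_of_surjective (Ideal.Quotient.factor hpq)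
      (Ideal.Quotient.factor_surjective hpq) (r := Ideal.Quotient.mk p r)
      (mem_nonZeroDivisors_of_ne_zero (by rwa [ne_eq, Ideal.Quotient.eq_zero_iff_mem]))
      (by simpa [Ideal.Quotient.eq_zero_iff_mem] using hrq)
    refine le_trans ?_ hdim
    rw [List.length_cons, Nat.cast_add, Nat.cast_one]
    gcongr
    exact ih hrs (fun a ha ↦ hmem a (by simp [ha])) hq

/-- Any regular element x, not just the head of `rs`, lowers depth by at most one: depth is read off
from vanishing Ext, and the long exact sequence of multiplication by x shifts the range by one. -/
lemma exists_isRegular_quotSMulTop {M : Type u} [AddCommGroup M] [Module R M] [Module.Finite R M]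
    [Nontrivial M] {rs : List R} {n : ℕ} (hn : rs.length = n + 1) (hrs : IsRegular M rs)
    (hmem : ∀ r ∈ rs, r ∈ maximalIdeal R) {x : R} (hx : x ∈ maximalIdeal R)
    (hreg : IsSMulRegular M x) :
    ∃ rs' : List R, rs'.length = n ∧ (∀ r ∈ rs', r ∈ maximalIdeal R) ∧
      IsRegular (QuotSMulTop x M) rs' := by
  have hlt (P : Type u) [AddCommGroup P] [Module R P] [Module.Finite R P] [Nontrivial P] :
      maximalIdeal R • (⊤ : Submodule R P) < ⊤ :=
    lt_top_iff_ne_top.mpr (Submodule.top_ne_ideal_smul_of_le_jacobson_annihilator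
      (maximalIdeal_le_jacobson _)).symm
  have := nontrivial_quotSMulTop_of_mem_maximalIdeal M hx
  have key := (ModuleCat.exists_isRegular_tfae (maximalIdeal R) (n + 1) (ModuleCat.of R M)
    (hlt M)).out 1 3
  have h := key.mpr ⟨rs, hn, hmem, hrs⟩
  refine ((ModuleCat.exists_isRegular_tfae (maximalIdeal R) n
    (ModuleCat.of R (QuotSMulTop x M)) (hlt _)).out 1 3).mp fun i hi ↦ ?_
  have zero1 := AddCommGrpCat.isZero_of_iff_subsingleton.mpr (h i (by omega))
  have zero2 := AddCommGrpCat.isZero_of_iff_subsingleton.mpr (h (i + 1) (by omega))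
  exact AddCommGrpCat.subsingleton_of_isZero <| ShortComplex.Exact.isZero_of_both_zeros
    ((Abelian.Ext.covariant_sequence_exact₃' _ (IsSMulRegular.smulShortComplex_shortExact
      (M := ModuleCat.of R M) hreg)) i (i + 1) rfl)
    (zero1.eq_zero_of_src _) (zero2.eq_zero_of_tgt _)

/-- In a module of depth at least `n`, every system of parameters of length `n` is regular. -/
lemma RingTheory.Sequence.IsRegular.isWeaklyRegular_of_forall_isPrime {M : Type u} [AddCommGroup M]
    [Module R M] [Module.Finite R M] [Nontrivial M] {rs xs : List R} (hrs : IsRegular M rs)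
    (hmem : ∀ r ∈ rs, r ∈ maximalIdeal R) (hlen : rs.length = xs.length)
    (hxs : ∀ x ∈ xs, x ∈ maximalIdeal R)
    (hprime : ∀ q : Ideal R, q.IsPrime → Module.annihilator R M ≤ q → (∀ x ∈ xs, x ∈ q) →
      q = maximalIdeal R) : IsWeaklyRegular M xs := by
  induction xs generalizing M rs with
  | nil => simp
  | cons x xs ih =>
    have hx := hxs x (by simp)
    -- Otherwise x lies in an associated prime p. Depth forces dim R/p ≥ |xs| + 1, while the |xs|
    -- remaining elements already cut R/p down to dimension 0.
    have hreg : IsSMulRegular M x := by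
      by_contra h
      obtain ⟨m, hm, hm0⟩ : ∃ m : M, m ≠ 0 ∧ x • m = 0 := by
        rw [isSMulRegular_iff_right_eq_zero_of_smul] at h
        push Not at h
        exact h.imp fun _ h ↦ h.symm
      have hmem' : x ∈ ⋃ p ∈ associatedPrimes R M, (p : Set R) := by
        rw [biUnion_associatedPrimes_eq_zero_divisors]
        exact ⟨m, hm, hm0⟩
      obtain ⟨p, hp, hxp⟩ := Set.mem_iUnion₂.mp hmem'
      have hdim := hrs.length_le_ringKrullDim_quotient hmem hp
      have := hp.isPrime
      have : IsLocalRing (R ⧸ p) := .of_surjective' _ Ideal.Quotient.mk_surjective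
      classical
      let s : Finset (R ⧸ p) := (xs.map (Ideal.Quotient.mk p)).toFinset
      have hs : (s : Set (R ⧸ p)) ⊆ Ring.jacobson (R ⧸ p) := by
        rw [IsLocalRing.ringJacobson_eq_maximalIdeal]
        intro y hy
        obtain ⟨z, hz, rfl⟩ : ∃ z ∈ xs, Ideal.Quotient.mk p z = y := by simpa [s] using hy
        have := ((IsLocalRing.local_hom_TFAE (Ideal.Quotient.mk p)).out 0 4).mp
          (IsLocalHom.of_surjective _ Ideal.Quotient.mk_surjective)
        exact this.ge (hxs z (by simp [hz]))
      have hle := ringKrullDim_le_ringKrullDim_quotient_add_card s hs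
      have hzero : ringKrullDim ((R ⧸ p) ⧸ Ideal.span (s : Set (R ⧸ p))) ≤ 0 := by
        have : Ring.KrullDimLE 0 ((R ⧸ p) ⧸ Ideal.span (s : Set (R ⧸ p))) := by
          refine .mk₀ fun I hI ↦ ?_
          let f := (Ideal.Quotient.mk (Ideal.span (s : Set (R ⧸ p)))).comp (Ideal.Quotient.mk p)
          have hf : Function.Surjective f :=
            Ideal.Quotient.mk_surjective.comp Ideal.Quotient.mk_surjective
          have hker (y : R) (hy : f y = 0) : y ∈ I.comap f := by simp [Ideal.mem_comap, hy]
          have hpI : p ≤ I.comap f := fun y hy ↦ hker y (by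
            simp [f, Ideal.Quotient.eq_zero_iff_mem.mpr hy])
          have hmax : I.comap f = maximalIdeal R := by
            refine hprime _ inferInstance ?_ ?_
            · rw [← Submodule.annihilator_top]
              exact hp.annihilator_le.trans hpI
            · intro z hz
              rcases List.mem_cons.mp hz with rfl | hz
              · exact hpI hxp
              · refine hker z (Ideal.Quotient.eq_zero_iff_mem.mpr (Ideal.subset_span ?_))
                simpa [s] using ⟨z, hz, rfl⟩
          have : (I.comap f).IsMaximal := hmax ▸ inferInstance
          rw [← Ideal.map_comap_of_surjective f hf I]
          exact (Ideal.map_eq_top_or_isMaximal_of_surjective f hf this).resolve_left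
            (by rw [Ideal.map_comap_of_surjective f hf I]; exact hI.ne_top)
        exact Ring.krullDimLE_iff.mp this
      have hcard : s.card ≤ xs.length := (List.toFinset_card_le _).trans (by simp)
      have := (hdim.trans hle).trans (add_le_add hzero (Nat.cast_le.mpr hcard))
      rw [hlen, zero_add, Nat.cast_le] at this
      simp at this
    obtain ⟨rs', hlen', hmem', hrs'⟩ := exists_isRegular_quotSMulTop
      (n := xs.length) (by simpa using hlen) hrs hmem hx hreg
    have := nontrivial_quotSMulTop_of_mem_maximalIdeal M hx
    refine .cons hreg (ih hrs' hmem' hlen' (fun y hy ↦ hxs y (by simp [hy])) fun q hq hann hqx ↦ ?_)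
    refine hprime q hq ?_ fun y hy ↦ ?_
    · exact (LinearMap.annihilator_le_of_surjective _ (Submodule.mkQ_surjective _)).trans hann
    · rcases List.mem_cons.mp hy with rfl | hy
      · refine hann (Module.mem_annihilator.mpr fun m ↦ ?_)
        obtain ⟨m, rfl⟩ := Submodule.mkQ_surjective _ m
        rw [← map_smul, Submodule.mkQ_apply, Submodule.Quotient.mk_eq_zero]
        exact Submodule.smul_mem_pointwise_smul _ _ _ trivial
      · exact hqx y hy

end Depth

/-! ### Quasi-finite extensions of domains are algebraic -/

section QuasiFinite

open TensorProduct in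
lemma Algebra.QuasiFinite.isAlgebraic {R S : Type*} [CommRing R] [CommRing S] [IsDomain R]
    [IsDomain S] [Algebra R S] [Algebra.QuasiFinite R S]
    (h : Function.Injective (algebraMap R S)) : Algebra.IsAlgebraic R S := by
  have : FaithfulSMul R S := (faithfulSMul_iff_algebraMap_injective R S).mpr h
  let K := FractionRing R
  let F := FractionRing S
  let : Algebra K F := FractionRing.liftAlgebra R F
  have : IsScalarTower R K F := FractionRing.isScalarTower_liftAlgebra R F
  have : Module.Finite K (K ⊗[R] S) := .of_quasiFinite
  let φ : K ⊗[R] S →ₐ[K] F :=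
    Algebra.TensorProduct.lift (Algebra.ofId K F) (IsScalarTower.toAlgHom R S F)
      fun _ _ ↦ .all _ _
  refine ⟨fun s ↦ ?_⟩
  have hs : IsAlgebraic K (algebraMap S F s) := by
    have : IsIntegral K (φ (1 ⊗ₜ s)) := (Algebra.IsIntegral.isIntegral (R := K) _).map φ
    simpa [φ] using this.isAlgebraic
  rw [← IsFractionRing.isAlgebraic_iff R K F] at hs
  exact (isAlgebraic_algebraMap_iff (IsFractionRing.injective S F)).mp hs

end QuasiFinite

/-! ### The variables as a regular sequence, and translations -/

section MvPolynomial

open MvPolynomial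

lemma MvPolynomial.isWeaklyRegular_ofFn_X (R : Type*) [CommRing R] (n : ℕ) :
    IsWeaklyRegular (MvPolynomial (Fin n) R) (List.ofFn fun i ↦ (X i : MvPolynomial (Fin n) R)) := by
  refine ⟨fun i hi ↦ ?_⟩
  rw [List.length_ofFn] at hi
  have hspan : Ideal.ofList ((List.ofFn fun i ↦ (X i : MvPolynomial (Fin n) R)).take i) =
      Ideal.span (X '' {j : Fin n | (j : ℕ) < i}) := by
    refine congrArg Ideal.span (Set.ext fun p ↦ ?_)
    simp only [Set.mem_ofPred_eq, Set.mem_image, List.mem_take_iff_getElem, List.getElem_ofFn,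
      List.length_ofFn]
    constructor
    · rintro ⟨j, hj, rfl⟩
      exact ⟨⟨j, by omega⟩, by simp; omega, rfl⟩
    · rintro ⟨j, hj, rfl⟩
      exact ⟨j, by omega, rfl⟩
  rw [hspan, List.getElem_ofFn, isSMulRegular_iff_right_eq_zero_of_smul]
  intro y hy
  obtain ⟨p, rfl⟩ := Submodule.mkQ_surjective _ y
  rw [← map_smul, Submodule.mkQ_apply, Submodule.Quotient.mk_eq_zero] at hy
  rw [Submodule.mkQ_apply, Submodule.Quotient.mk_eq_zero]
  simp only [smul_eq_mul, Ideal.mul_top, mem_ideal_span_X_image] at hy ⊢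
  intro m hm
  -- Multiplying by X_i changes only the i-th exponent, so it cannot affect membership in the
  -- monomial ideal (X_j : j < i).
  obtain ⟨j, hj, hmj⟩ := hy (m + Finsupp.single ⟨i, hi⟩ 1) (by
    rw [mem_support_iff, mul_comm, coeff_mul_X]
    exact mem_support_iff.mp hm)
  refine ⟨j, hj, ?_⟩
  have : (⟨i, hi⟩ : Fin n) ≠ j := by
    rintro rfl
    simp at hj
  simpa [Finsupp.single_apply, this] using hmj

lemma MvPolynomial.eq_span_range_X {L σ : Type*} [Field L] {p : Ideal (MvPolynomial σ L)}
    (hp : p ≠ ⊤) (hX : ∀ i, X i ∈ p) : p = Ideal.span (Set.range X) := by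
  refine le_antisymm (fun f hf ↦ ?_) (Ideal.span_le.mpr (Set.range_subset_iff.mpr hX))
  have key (f : MvPolynomial σ L) : f - C (constantCoeff f) ∈ Ideal.span (Set.range X) := by
    induction f using MvPolynomial.induction_on with
    | C a => simp
    | add f g hf hg =>
      convert add_mem hf hg using 1
      simp only [map_add]
      ring
    | mul_X f i _ =>
      simpa using Ideal.mul_mem_left _ f (Ideal.subset_span (Set.mem_range_self i))
  have hc : C (constantCoeff f) ∈ p := by
    have := sub_mem hf (Ideal.span_le.mpr (Set.range_subset_iff.mpr hX) (key f))
    simpa using this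
  have h0 : constantCoeff f = 0 := by
    by_contra h
    exact hp (Ideal.eq_top_of_isUnit_mem _ hc ((isUnit_iff_ne_zero.mpr h).map C))
  simpa [h0] using key f

/-- The translation of affine space by a point. -/
noncomputable def MvPolynomial.translate {L σ : Type*} [CommRing L] (a : σ → L) :
    MvPolynomial σ L ≃ₐ[L] MvPolynomial σ L :=
  AlgEquiv.ofAlgHom (aeval fun i ↦ X i - C (a i)) (aeval fun i ↦ X i + C (a i))
    (by ext; simp) (by ext; simp)

end MvPolynomial

/-! ### Local rings étale over affine space -/

section Etale

open MvPolynomial IsLocalRing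

variable {L : Type*} [Field L] {n : ℕ} {S O : Type*} [CommRing S]
  [Algebra (MvPolynomial (Fin n) L) S] [Algebra.Etale (MvPolynomial (Fin n) L) S]
  (q : Ideal S) [q.IsPrime] [CommRing O] [Algebra S O] [IsLocalization.AtPrime O q]
  [Algebra (MvPolynomial (Fin n) L) O] [IsScalarTower (MvPolynomial (Fin n) L) S O]

include q

lemma Algebra.Etale.isWeaklyRegular_map_X :
    IsWeaklyRegular O ((List.ofFn X).map (algebraMap (MvPolynomial (Fin n) L) O)) := by
  have : Module.Flat S O := IsLocalization.flat O q.primeCompl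
  have : Module.Flat (MvPolynomial (Fin n) L) O := .trans _ S O
  exact (isWeaklyRegular_ofFn_X L n).of_flat

variable [IsLocalRing O]

lemma Algebra.Etale.map_under_eq_maximalIdeal :
    (q.under (MvPolynomial (Fin n) L)).map (algebraMap (MvPolynomial (Fin n) L) O) =
      maximalIdeal O := by
  let P := MvPolynomial (Fin n) L
  let : Algebra (Localization.AtPrime (q.under P)) (Localization.AtPrime q) :=
    Localization.AtPrime.algebraOfLiesOver (q.under P) q
  have : Localization.AtPrime.IsLiesOverAlgebra (q.under P) q := inferInstance
  have h := ((Algebra.isUnramifiedAt_iff_map_eq P (q.under P) q).mp inferInstance).2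
  let e := IsLocalization.algEquiv q.primeCompl (Localization.AtPrime q) O
  rw [IsScalarTower.algebraMap_eq P S O, ← e.toAlgHom.comp_algebraMap, RingHom.comp_assoc,
    ← IsScalarTower.algebraMap_eq P S, ← Ideal.map_map, h]
  exact IsLocalRing.map_ringEquiv_maximalIdeal e.toRingEquiv

lemma Algebra.Etale.ofList_map_X_eq_maximalIdeal
    (hX : ∀ i, algebraMap (MvPolynomial (Fin n) L) O (X i) ∈ maximalIdeal O) :
    Ideal.ofList ((List.ofFn X).map (algebraMap (MvPolynomial (Fin n) L) O)) = maximalIdeal O := by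
  have hq : q.under (MvPolynomial (Fin n) L) = Ideal.ofList (List.ofFn X) := by
    rw [eq_span_range_X (p := q.under (MvPolynomial (Fin n) L)) Ideal.IsPrime.ne_top' fun i ↦ ?_]
    · exact congrArg Ideal.span (Set.ext fun p ↦ by simp [List.mem_ofFn])
    · have := hX i
      rwa [IsScalarTower.algebraMap_apply _ S O,
        IsLocalization.AtPrime.to_map_mem_maximal_iff O q] at this
  rw [← Ideal.map_ofList, ← hq, map_under_eq_maximalIdeal q]

lemma Algebra.Etale.injective_algebraMap :
    Function.Injective (algebraMap (MvPolynomial (Fin n) L) O) := by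
  have : Module.Flat S O := IsLocalization.flat O q.primeCompl
  have : Module.Flat (MvPolynomial (Fin n) L) O := .trans _ S O
  exact FaithfulSMul.algebraMap_injective _ _

lemma Algebra.Etale.trdeg_eq [IsDomain O] [Algebra L O]
    [IsScalarTower L (MvPolynomial (Fin n) L) O] : Algebra.trdeg L O = n := by
  have hinj := injective_algebraMap (L := L) (n := n) (O := O) q
  have : FaithfulSMul (MvPolynomial (Fin n) L) O :=
    (faithfulSMul_iff_algebraMap_injective _ _).mpr hinj
  have : Algebra.QuasiFinite S O := .of_isLocalization q.primeCompl
  have : Algebra.QuasiFinite (MvPolynomial (Fin n) L) O := .trans _ S O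
  have : Algebra.IsAlgebraic (MvPolynomial (Fin n) L) O := QuasiFinite.isAlgebraic hinj
  have h := lift_trdeg_add_eq L (MvPolynomial (Fin n) L) O
  rw [trdeg_eq_zero (R := MvPolynomial (Fin n) L), trdeg_of_isDomain] at h
  simpa using h.symm

end Etale

/-! ### Regular parameters on standard smooth algebras -/

section StandardSmooth

open MvPolynomial IsLocalRing

/-- The local ring at a rational point of a standard smooth algebra over a field has a regular
system of parameters, whose length is the transcendence degree. -/
theorem RingHom.IsStandardSmooth.exists_regularParameters {L S O : Type u} [Field L] [CommRing S]
    {f : L →+* S} (hf : f.IsStandardSmooth) (q : Ideal S) [q.IsPrime] [CommRing O]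
    [IsDomain O] [IsLocalRing O] [Algebra S O] [IsLocalization.AtPrime O q] [Algebra L O]
    (hL : algebraMap L O = (algebraMap S O).comp f)
    (hres : ∀ t : O, ∃ l : L, t - algebraMap L O l ∈ maximalIdeal O) :
    ∃ xs : List O, IsWeaklyRegular O xs ∧ Ideal.ofList xs = maximalIdeal O ∧
      Algebra.trdeg L O = xs.length := by
  obtain ⟨n, g, hg, hget⟩ := hf.exists_etale_mvPolynomial
  -- The residues of the étale coordinates; translating by them moves the image point to the origin.
  choose a ha using fun i ↦ hres (algebraMap S O (g (X i)))
  let h : MvPolynomial (Fin n) L →+* S := g.comp (MvPolynomial.translate a).toRingHom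
  have hh : h.Etale := RingHom.Etale.stableUnderComposition _ _
    (.of_bijective (MvPolynomial.translate a).bijective) hget
  algebraize [h, (algebraMap S O).comp h]
  have : IsScalarTower L (MvPolynomial (Fin n) L) O := .of_algebraMap_eq fun l ↦ by
    change algebraMap L O l = algebraMap S O (g (MvPolynomial.translate a (algebraMap L _ l)))
    rw [AlgEquiv.commutes, hL, ← hg]
    rfl
  refine ⟨(List.ofFn X).map (algebraMap (MvPolynomial (Fin n) L) O),
    Algebra.Etale.isWeaklyRegular_map_X q, Algebra.Etale.ofList_map_X_eq_maximalIdeal q fun i ↦ ?_,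
    by simpa using Algebra.Etale.trdeg_eq q⟩
  convert ha i
  change algebraMap S O (g (MvPolynomial.translate a (X i))) = _
  rw [hL, ← hg]
  simp [MvPolynomial.translate]

end StandardSmooth

/-! ### Quasi-finite maps between regular local rings -/

section LocalAlgebra

open IsLocalRing

lemma Algebra.QuasiFinite.isArtinianRing_quotient_map_maximalIdeal (B C : Type*) [CommRing B]
    [CommRing C] [IsLocalRing B] [Algebra B C] [Algebra.QuasiFinite B C] :
    IsArtinianRing (C ⧸ (maximalIdeal B).map (algebraMap B C)) := by
  let : Field (B ⧸ maximalIdeal B) := Ideal.Quotient.field _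
  have : Algebra.QuasiFinite (B ⧸ maximalIdeal B) (C ⧸ (maximalIdeal B).map (algebraMap B C)) :=
    .of_restrictScalars B _ _
  have : Module.Finite (B ⧸ maximalIdeal B) (C ⧸ (maximalIdeal B).map (algebraMap B C)) :=
    .of_quasiFinite
  exact .of_finite (B ⧸ maximalIdeal B) _

lemma Algebra.QuasiFinite.length_quotient_map_maximalIdeal_ne_top (B C : Type*) [CommRing B]
    [CommRing C] [IsLocalRing B] [Algebra B C] [Algebra.QuasiFinite B C] :
    Module.length C (C ⧸ (maximalIdeal B).map (algebraMap B C)) ≠ ⊤ := by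
  have := isArtinianRing_quotient_map_maximalIdeal B C
  rw [Module.length_eq_of_surjective (S := C)
    (R := C ⧸ (maximalIdeal B).map (algebraMap B C)) Ideal.Quotient.mk_surjective]
  exact Module.length_ne_top

/-- A quasi-finite local extension of regular local rings of the same dimension turns a regular
system of parameters into a regular sequence. -/
lemma Algebra.QuasiFinite.isWeaklyRegular_of_ofList_eq_maximalIdeal {B C : Type u} [CommRing B]
    [CommRing C] [IsLocalRing B] [IsLocalRing C] [IsNoetherianRing C] [Algebra B C]
    [IsLocalHom (algebraMap B C)] [Algebra.QuasiFinite B C] {xs : List B} {ys : List C}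
    (hxs : Ideal.ofList xs = maximalIdeal B) (hys : IsWeaklyRegular C ys)
    (hys' : Ideal.ofList ys = maximalIdeal C) (hlen : ys.length = xs.length) :
    IsWeaklyRegular C xs := by
  rw [← isWeaklyRegular_map_algebraMap_iff (S := C)]
  have hysmem : ∀ y ∈ ys, y ∈ maximalIdeal C := fun y hy ↦ hys' ▸ Ideal.subset_span hy
  refine (IsRegular.of_isWeaklyRegular_of_mem_maximalIdeal C hysmem
    hys).isWeaklyRegular_of_forall_isPrime hysmem (by simpa) ?_ ?_
  · intro y hy
    obtain ⟨x, hx, rfl⟩ := List.mem_map.mp hy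
    have hx' : x ∈ maximalIdeal B := hxs ▸ Ideal.subset_span hx
    exact map_nonunit (algebraMap B C) x hx'
  · intro q hq _ hqx
    have hle : (maximalIdeal B).map (algebraMap B C) ≤ q := by
      rw [← hxs, Ideal.map_ofList]
      exact Ideal.span_le.mpr hqx
    have := isArtinianRing_quotient_map_maximalIdeal B C
    have : IsArtinianRing (C ⧸ q) := (Ideal.Quotient.factor_surjective hle).isArtinianRing
    exact eq_maximalIdeal (Ideal.Quotient.maximal_of_isField q
      (IsArtinianRing.isField_of_isDomain _))

lemma Algebra.QuasiFinite.length_quotient_map_eq_mul {L B C : Type u} [Field L] [CommRing B]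
    [CommRing C] [IsDomain B] [IsDomain C] [IsLocalRing B] [IsLocalRing C] [IsNoetherianRing C]
    [Algebra L B] [Algebra L C] [Algebra B C] [IsScalarTower L B C] [IsLocalHom (algebraMap B C)]
    [Algebra.QuasiFinite B C] (hinj : Function.Injective (algebraMap B C))
    {xs : List B} (hxs : Ideal.ofList xs = maximalIdeal B) (htrB : Algebra.trdeg L B = xs.length)
    {ys : List C} (hys : IsWeaklyRegular C ys) (hys' : Ideal.ofList ys = maximalIdeal C)
    (htrC : Algebra.trdeg L C = ys.length) (I : Ideal B) (hI : Module.length B (B ⧸ I) ≠ ⊤) :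
    Module.length C (C ⧸ I.map (algebraMap B C)) =
      Module.length C (C ⧸ (maximalIdeal B).map (algebraMap B C)) * Module.length B (B ⧸ I) := by
  have : FaithfulSMul B C := (faithfulSMul_iff_algebraMap_injective B C).mpr hinj
  have : Algebra.IsAlgebraic B C := QuasiFinite.isAlgebraic hinj
  have hlen : ys.length = xs.length := by
    have := trdeg_add_eq L B (A := C)
    rw [trdeg_eq_zero (R := B), add_zero, htrB, htrC] at this
    exact_mod_cast this.symm
  have hreg := isWeaklyRegular_of_ofList_eq_maximalIdeal hxs hys hys' hlen
  refine length_quotient_map_of_lTensor_maximalIdeal_injective ?_ I hI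
  rw [← hxs]
  exact hreg.lTensor_subtype_injective

end LocalAlgebra

/-! ### Stalks of smooth integral schemes -/

section Stalk

open AlgebraicGeometry IsLocalRing

/-- A section whose germ pulls back to 0 pulls back to 0 on all of f⁻¹U, as X is integral. By
surjectivity its nonvanishing locus is empty, so it is 0 on the reduced Y. -/
lemma AlgebraicGeometry.Scheme.Hom.stalkMap_injective_of_surjective {X Y : Scheme.{u}}
    [IsIntegral X] [IsReduced Y] (f : X ⟶ Y) (hf : Function.Surjective f) (x : X) :
    Function.Injective (f.stalkMap x) := by
  obtain ⟨_, ⟨U, hU, rfl⟩, hxU, -⟩ := Y.isBasis_affineOpens.exists_subset_of_mem_open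
    (Set.mem_univ (f x)) isOpen_univ
  refine hU.stalkMap_injective f x hxU fun s hs ↦ ?_
  rw [Scheme.Hom.germ_stalkMap_apply] at hs
  have hs' : f.app U s = 0 :=
    germ_injective_of_isIntegral X x (U := f ⁻¹ᵁ U) hxU (by rw [hs, map_zero])
  suffices s = 0 by rw [this, map_zero]
  rw [← basicOpen_eq_bot_iff, ← TopologicalSpace.Opens.not_nonempty_iff_eq_bot]
  rintro ⟨y, hy⟩
  obtain ⟨z, rfl⟩ := hf y
  have hz : z ∈ f ⁻¹ᵁ Y.basicOpen s := hy
  rw [Scheme.preimage_basicOpen, (basicOpen_eq_bot_iff _).mpr hs'] at hz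
  exact hz

variable {L : Type u} [Field L]

/-- The structure map of the local ring of an `L`-scheme at a point. -/
noncomputable def AlgebraicGeometry.Scheme.Hom.toStalk {X : Scheme.{u}}
    (s : X ⟶ Spec (CommRingCat.of L)) (x : X) : CommRingCat.of L ⟶ X.presheaf.stalk x :=
  Spec.preimage (X.fromSpecStalk x ≫ s)

lemma AlgebraicGeometry.Scheme.Hom.SpecMap_toStalk {X : Scheme.{u}}
    (s : X ⟶ Spec (CommRingCat.of L)) (x : X) :
    Spec.map (s.toStalk x) = X.fromSpecStalk x ≫ s :=
  Spec.map_preimage _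

lemma AlgebraicGeometry.Scheme.Hom.toStalk_stalkMap {X Y : Scheme.{u}} (f : X ⟶ Y)
    (s : Y ⟶ Spec (CommRingCat.of L)) (x : X) :
    s.toStalk (f x) ≫ f.stalkMap x = (f ≫ s).toStalk x := by
  apply Spec.map_injective
  rw [Spec.map_comp, SpecMap_toStalk, SpecMap_toStalk,
    Scheme.SpecMap_stalkMap_fromSpecStalk_assoc]

lemma AlgebraicGeometry.Scheme.Hom.exists_sub_toStalk_mem_maximalIdeal [IsAlgClosed L]
    {X : Scheme.{u}} (s : X ⟶ Spec (CommRingCat.of L)) [LocallyOfFiniteType s] {x : X}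
    (hx : IsClosed {x}) (t : X.presheaf.stalk x) :
    ∃ l : L, t - (s.toStalk x).hom l ∈ maximalIdeal (X.presheaf.stalk x) := by
  have h : (residueFieldIsoBase s x hx).inv = s.toStalk x ≫ X.residue x := by
    apply Spec.map_injective
    rw [SpecMap_residueFieldIsoBase_inv, Spec.map_comp, SpecMap_toStalk,
      Scheme.fromSpecResidueField, Category.assoc]
  obtain ⟨l, hl⟩ := (ConcreteCategory.bijective_of_isIso (residueFieldIsoBase s x hx).inv).2
    (X.residue x t)
  refine ⟨l, ?_⟩
  rw [← residue_eq_zero_iff, map_sub, sub_eq_zero]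
  rw [h] at hl
  exact hl.symm

lemma AlgebraicGeometry.Smooth.exists_isStandardSmooth_toStalk {X : Scheme.{u}}
    (s : X ⟶ Spec (CommRingCat.of L)) [Smooth s] (x : X) :
    ∃ (V : X.Opens) (_ : IsAffineOpen V) (hx : x ∈ V) (φ : CommRingCat.of L ⟶ Γ(X, V)),
      φ.hom.IsStandardSmooth ∧ s.toStalk x = φ ≫ X.presheaf.germ V x hx := by
  obtain ⟨U, hU, V, hV, hx, e, h⟩ := Smooth.exists_isStandardSmooth s x
  -- Spec L is a single point, so the nonempty open U is everything and its ring of sections is L.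
  have : IsIso hU.fromSpec := by
    refine isIso_of_isOpenImmersion_of_opensRange_eq_top _ ?_
    rw [hU.opensRange_fromSpec]
    refine top_le_iff.mp fun y _ ↦ ?_
    have : y = s x := Subsingleton.elim (α := PrimeSpectrum L) _ _
    exact this ▸ e hx
  let ψ : CommRingCat.of L ⟶ Γ(Spec (CommRingCat.of L), U) := Spec.preimage hU.fromSpec
  have hψ : Spec.map ψ = hU.fromSpec := Spec.map_preimage _
  have : IsIso (Spec.map ψ) := hψ ▸ this
  have : IsIso (Scheme.Spec.map ψ.op) := this
  have : IsIso ψ.op := isIso_of_reflects_iso ψ.op Scheme.Spec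
  have : IsIso ψ := (isIso_op_iff ψ).mp this
  refine ⟨V, hV, hx, ψ ≫ s.appLE U V e, ?_, ?_⟩
  · rw [CommRingCat.hom_comp]
    exact RingHom.isStandardSmooth_respectsIso.2 _ (asIso ψ).commRingCatIsoToRingEquiv h
  · apply Spec.map_injective
    rw [Scheme.Hom.SpecMap_toStalk, Spec.map_comp, Spec.map_comp, hψ,
      hU.SpecMap_appLE_fromSpec s hV e, ← Category.assoc, ← IsAffineOpen.fromSpecStalk,
      IsAffineOpen.fromSpecStalk_eq_fromSpecStalk]

/-- The local ring of a smooth integral scheme over an algebraically closed field at a closed point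
has a regular system of parameters, whose length is the transcendence degree. -/
lemma AlgebraicGeometry.Smooth.exists_regularParameters [IsAlgClosed L] {X : Scheme.{u}}
    [IsIntegral X] (s : X ⟶ Spec (CommRingCat.of L)) [Smooth s] {x : X} (hx : IsClosed {x}) :
    ∃ xs : List (X.presheaf.stalk x), IsWeaklyRegular (X.presheaf.stalk x) xs ∧
      Ideal.ofList xs = maximalIdeal (X.presheaf.stalk x) ∧
      letI := (s.toStalk x).hom.toAlgebra
      Algebra.trdeg L (X.presheaf.stalk x) = xs.length := by
  obtain ⟨V, hV, hxV, φ, hφ, h⟩ := exists_isStandardSmooth_toStalk s x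
  let := (s.toStalk x).hom.toAlgebra
  let := X.presheaf.algebra_section_stalk ⟨x, hxV⟩
  have := hV.isLocalization_stalk ⟨x, hxV⟩
  refine hφ.exists_regularParameters (hV.primeIdealOf ⟨x, hxV⟩).asIdeal
    (congrArg CommRingCat.Hom.hom h) fun t ↦ ?_
  exact s.exists_sub_toStalk_mem_maximalIdeal hx t

end Stalk

/-! ### Finiteness and multiplicativity of multiplicities -/

section Multiplicity

open AlgebraicGeometry IsLocalRing

lemma algMultiplicity_ne_top {X Y : Scheme.{u}} (f : X ⟶ Y) [IsFinite f] (a : X) :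
    algMultiplicity f a ≠ ⊤ := by
  have h : (f.stalkMap a).hom.QuasiFinite := f.quasiFiniteAt a
  algebraize [(f.stalkMap a).hom]
  exact Algebra.QuasiFinite.length_quotient_map_maximalIdeal_ne_top _ _

lemma algMultiplicity_comp {L : Type u} [Field L] [IsAlgClosed L] {X Y Z : Scheme.{u}}
    [IsIntegral X] [IsIntegral Y] (s : Y ⟶ Spec (CommRingCat.of L)) [Smooth s]
    (f : X ⟶ Y) [IsFinite f] [Smooth (f ≫ s)] (hf : Function.Surjective f)
    (g : Y ⟶ Z) [IsFinite g] {a : X} (ha : IsClosed {a}) :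
    algMultiplicity (f ≫ g) a = algMultiplicity f a * algMultiplicity g (f a) := by
  have hfa : IsClosed {f a} := by
    simpa using f.isClosedMap _ ha
  obtain ⟨xs, -, hxs, htrx⟩ := Smooth.exists_regularParameters s hfa
  obtain ⟨ys, hys, hys', htry⟩ := Smooth.exists_regularParameters (f ≫ s) ha
  have : IsLocallyNoetherian X := LocallyOfFiniteType.isLocallyNoetherian (f ≫ s)
  have h : (f.stalkMap a).hom.QuasiFinite := f.quasiFiniteAt a
  let := (s.toStalk (f a)).hom.toAlgebra
  let := ((f ≫ s).toStalk a).hom.toAlgebra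
  algebraize [(f.stalkMap a).hom]
  have : IsScalarTower L (Y.presheaf.stalk (f a)) (X.presheaf.stalk a) :=
    .of_algebraMap_eq' (congrArg CommRingCat.Hom.hom (f.toStalk_stalkMap s a)).symm
  have : IsLocalHom (algebraMap (Y.presheaf.stalk (f a)) (X.presheaf.stalk a)) :=
    inferInstanceAs (IsLocalHom (f.stalkMap a).hom)
  have key := Algebra.QuasiFinite.length_quotient_map_eq_mul (L := L)
    (f.stalkMap_injective_of_surjective hf a) hxs htrx hys hys' htry _
    (algMultiplicity_ne_top g (f a))
  rw [Ideal.map_map] at key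
  rw [algMultiplicity, Scheme.Hom.stalkMap_comp]
  exact key

end Multiplicity

theorem theorem5p10 {L : Type u} [Field L] [IsAlgClosed L]
    {X₃ X₂ X₁ : AlgebraicGeometry.Scheme.{u}}
    (s₃ : X₃ ⟶ AlgebraicGeometry.Spec (CommRingCat.of L))
    (s₂ : X₂ ⟶ AlgebraicGeometry.Spec (CommRingCat.of L))
    (s₁ : X₁ ⟶ AlgebraicGeometry.Spec (CommRingCat.of L))
    (h₃ : IsSmoothProjectiveVariety s₃) (h₂ : IsSmoothProjectiveVariety s₂)
    (h₁ : IsSmoothProjectiveVariety s₁)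
    (f : X₃ ⟶ X₂) (hf : AlgebraicGeometry.IsFinite f) (hfs : f ≫ s₂ = s₃)
    (hfsurj : Function.Surjective f)
    (g : X₂ ⟶ X₁) (hg : AlgebraicGeometry.IsFinite g) (hgs : g ≫ s₁ = s₂)
    (a : X₃) (ha : IsClosed {a}) :
    algMultiplicity f a ≠ ⊤ ∧ algMultiplicity g (f a) ≠ ⊤ ∧
      algMultiplicity f a * algMultiplicity g (f a) = algMultiplicity (f ≫ g) a := by

  subst hfs
  have := h₂.isIntegral
  have := h₃.isIntegral
  have := h₂.smooth
  have := h₃.smooth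
  exact ⟨algMultiplicity_ne_top f a, algMultiplicity_ne_top g (f a),
    (algMultiplicity_comp s₂ f hfsurj g ha).symm⟩
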